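/- Let $\mathscr{R}$ be a finite von Neumann algebra acting on a complex Hilbert space $\mathscr{H}$ (that is, $V\in\mathscr{R}$ and $V^*V=I$ imply $VV^*=I$), and let $\mathscr{R}_{\mathrm{aff}}$ be the set of closed densely defined operators $T$ on $\mathscr{H}$ that are affiliated with $\mathscr{R}$, i.e. $U^*TU=T$ (with equality of domains) for every unitary $U$ in the commutant $\mathscr{R}'$. For $S,T\in\mathscr{R}_{\mathrm{aff}}$ let $S\,\hat\cdot\,T$ and $S\,\hat-\,T$ denote the closures of the operator product $ST$ (with domain $\{x\in\mathscr{D}(T): Tx\in\mathscr{D}(S)\}$) and of the difference $S-T$ (with domain $\mathscr{D}(S)\cap\mathscr{D}(T)$); these are the product and the difference of the Murray-von Neumann algebra $\mathscr{R}_{\mathrm{aff}}$. For self-adjoint $S,T\in\mathscr{R}_{\mathrm{aff}}$ write $S\le T$ if $T\,\hat-\,S$ is positive, i.e. self-adjoint with $\langle (T\,\hat-\,S)x,x\rangle\ge 0$ for every $x$ in its domain. Then for all $A,B\in\mathscr{R}_{\mathrm{aff}}$ the following are equivalent: (i) $A^*\,\hat\cdot\,A\le B^*\,\hat\cdot\,B$;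 (ii) there is $C\in\mathscr{R}$ with $\|C\|\le 1$ such that $A=C\,\hat\cdot\,B$. -/

import Mathlib

open scoped LinearPMap

namespace MurrayVonNeumann

variable {H : Type*} [NormedAddCommGroup H] [InnerProductSpace ℂ H] [CompleteSpace H]

/-- A von Neumann algebra `R` is finite if its identity is a finite projection: the identity is not
Murray-von Neumann equivalent, relative to `R`, to a proper subprojection. In other words, if
`V ∈ R` satisfies `V* V = I`, then the projection `V V*` is `I`. -/
def IsFinite (R : VonNeumannAlgebra H) : Prop :=
  ∀ V ∈ R, star V * V = 1 → V * star V = 1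

/-- An everywhere defined bounded operator, seen as an unbounded operator with domain `H`. -/
def ofBounded (C : H →L[ℂ] H) : H →ₗ.[ℂ] H :=
  (C : H →ₗ[ℂ] H).toPMap ⊤

/-- The product `S T` of unbounded operators: its domain consists of the `x ∈ D(T)` with
`T x ∈ D(S)`, and there `(S T) x = S (T x)`. -/
def opMul (S T : H →ₗ.[ℂ] H) : H →ₗ.[ℂ] H where
  domain :=
    { carrier := {x | ∃ h : x ∈ T.domain, T ⟨x, h⟩ ∈ S.domain}
      zero_mem' := ⟨T.domain.zero_mem, by
        have h : T ⟨0, T.domain.zero_mem⟩ = 0 := T.map_zero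
        rw [h]; exact S.domain.zero_mem⟩
      add_mem' := by
        rintro x y ⟨hx, hx'⟩ ⟨hy, hy'⟩
        refine ⟨T.domain.add_mem hx hy, ?_⟩
        have h : T ⟨x + y, T.domain.add_mem hx hy⟩ = T ⟨x, hx⟩ + T ⟨y, hy⟩ :=
          T.map_add ⟨x, hx⟩ ⟨y, hy⟩
        rw [h]; exact S.domain.add_mem hx' hy'
      smul_mem' := by
        rintro c x ⟨hx, hx'⟩
        refine ⟨T.domain.smul_mem c hx, ?_⟩
        have h : T ⟨c • x, T.domain.smul_mem c hx⟩ = c • T ⟨x, hx⟩ := T.map_smul c ⟨x, hx⟩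
        rw [h]; exact S.domain.smul_mem c hx' }
  toFun :=
    { toFun := fun x => S ⟨T ⟨x.1, x.2.fst⟩, x.2.snd⟩
      map_add' := by
        rintro ⟨x, hx, hx'⟩ ⟨y, hy, hy'⟩
        rw [← S.map_add]
        congr 1
        exact Subtype.ext (T.map_add ⟨x, hx⟩ ⟨y, hy⟩)
      map_smul' := by
        rintro c ⟨x, hx, hx'⟩
        rw [RingHom.id_apply, ← S.map_smul]
        congr 1
        exact Subtype.ext (T.map_smul c ⟨x, hx⟩) }

/-- `T` belongs to `R_aff`: it is a closed densely defined operator affiliated with `R`, that is,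
`U* T U = T` (with equality of domains) for every unitary `U` in the commutant of `R`. -/
structure IsAffiliated (R : VonNeumannAlgebra H) (T : H →ₗ.[ℂ] H) : Prop where
  dense_domain : Dense (T.domain : Set H)
  isClosed : T.IsClosed
  conj_eq : ∀ U ∈ R.commutant, U ∈ unitary (H →L[ℂ] H) →
    opMul (ofBounded (star U)) (opMul T (ofBounded U)) = T

/-- The strong product of affiliated operators: the closure of `S T`. When `S` and `T` are
affiliated with a finite von Neumann algebra, `S T` is densely defined and closable, and its closure
is its unique affiliated closed extension. -/
noncomputable def strongMul (S T : H →ₗ.[ℂ] H) : H →ₗ.[ℂ] H :=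
  (opMul S T).closure

/-- The strong difference of affiliated operators: the closure of `S - T`, which is defined on
`D(S) ∩ D(T)`. -/
noncomputable def strongSub (S T : H →ₗ.[ℂ] H) : H →ₗ.[ℂ] H :=
  (S - T).closure

/-- A positive operator: self-adjoint, with nonnegative quadratic form. -/
def IsPositiveOp (T : H →ₗ.[ℂ] H) : Prop :=
  IsSelfAdjoint T ∧ ∀ x : T.domain, 0 ≤ (inner ℂ (T x) (x : H)).re

/-- The order on the self-adjoint operators in `R_aff`: `S ≤ T` if the strong difference of `T` and
`S` is a positive operator. -/
structure AffLE (R : VonNeumannAlgebra H) (S T : H →ₗ.[ℂ] H) : Prop where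
  left_affiliated : IsAffiliated R S
  left_selfAdjoint : IsSelfAdjoint S
  right_affiliated : IsAffiliated R T
  right_selfAdjoint : IsSelfAdjoint T
  positive_sub : IsPositiveOp (strongSub T S)

end MurrayVonNeumann

/-! The proof replaces unbounded operators by pairs of bounded ones. The graph of an affiliated `T`
is `{(e x, f x)}` with `e, f ∈ R` and `e* e + f* f = 1` (`exists_graph_eq_pairRange`). If one such
subspace contains another, the two differ by an isometry of `R`, which finiteness makes unitary, so
they are equal (`pairRange_eq_of_le`). Hence a part of the graph of `A` that is parametrized by `R`
and has dense first coordinates is a core. Finiteness also makes the ranges of two operators of `R`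
with dense range meet densely, which gives `m ∈ R` with dense range on which `A`, `B`, `A† A`, `B†
B` are all defined (`exists_common_domain`).

(i) ⇒ (ii): on the range of `m` the order says `‖A x‖ ≤ ‖B x‖`. Douglas factorization gives a
contraction `C ∈ R` with `A = C B` there, and that part of the graph is a core both for `A` and for
the closure of `C B`.

(ii) ⇒ (i): `B† B - A† A` is symmetric with form `‖B x‖² - ‖C B x‖² ≥ 0`. Its closure is
self-adjoint because its deficiency spaces vanish, again by finiteness
(`isSelfAdjoint_closure_of_symmetric`). -/

set_option linter.unusedSectionVars false

namespace MurrayVonNeumann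

variable {H : Type*} [NormedAddCommGroup H] [InnerProductSpace ℂ H] [CompleteSpace H]
variable {R : VonNeumannAlgebra H}

/-! ### Membership in a von Neumann algebra and Douglas factorization -/

theorem mem_iff_commute_commutant {x : H →L[ℂ] H} :
    x ∈ R ↔ ∀ u ∈ R.commutant, u * x = x * u := by
  conv_lhs => rw [← R.commutant_commutant]
  exact VonNeumannAlgebra.mem_commutant_iff

theorem real_smul_mem {x : H →L[ℂ] H} (hx : x ∈ R) (r : ℝ) : r • x ∈ R :=
  R.toStarSubalgebra.smul_mem (x := x) hx (r : ℂ)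

theorem complex_smul_mem {x : H →L[ℂ] H} (hx : x ∈ R) (r : ℂ) : r • x ∈ R :=
  R.toStarSubalgebra.smul_mem (x := x) hx r

theorem sqrt_mem {t : H →L[ℂ] H} (ht : t ∈ R) : CFC.sqrt t ∈ R := by
  rw [mem_iff_commute_commutant]
  intro u hu
  have h : Commute t u := (mem_iff_commute_commutant.1 ht u hu).symm
  exact (h.cfcₙ_nnreal NNReal.sqrt).eq.symm

/-- A self-adjoint contraction `a` is the mean of the unitaries `a ± i √(1 - a²)`, so unitaries span
the commutant. Affiliation only gives information about unitaries; this turns it into membership in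
`R`. -/
theorem mem_of_commute_unitary {x : H →L[ℂ] H}
    (h : ∀ u ∈ R.commutant, u ∈ unitary (H →L[ℂ] H) → u * x = x * u) : x ∈ R := by
  have key : ∀ a ∈ R.commutant, IsSelfAdjoint a → ‖a‖ ≤ 1 → a * x = x * a := by
    intro a ha hsa hn
    set s := CFC.sqrt (1 - a ^ 2) with hs
    have hsm : s ∈ R.commutant :=
      sqrt_mem (sub_mem (one_mem _) (pow_mem ha 2))
    have hss : star s = s := (CFC.sqrt_nonneg (1 - a ^ 2)).isSelfAdjoint
    have hu := hsa.self_add_I_smul_cfcSqrt_sub_sq_mem_unitary a hn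
    rw [← hs] at hu
    have hum : a + Complex.I • s ∈ R.commutant := add_mem ha (complex_smul_mem hsm _)
    have h1 := h _ hum hu
    have h2 := h _ (star_mem hum) (Unitary.star_mem hu)
    have h3 : star (a + Complex.I • s) = a - Complex.I • s := by
      rw [star_add, star_smul, hss, hsa.star_eq]
      simp [sub_eq_add_neg]
    rw [h3] at h2
    have h4 : a = (2⁻¹ : ℂ) • ((a + Complex.I • s) + (a - Complex.I • s)) := by
      rw [add_add_sub_cancel, ← two_smul ℂ a, smul_smul]; norm_num
    rw [h4, smul_mul_assoc, mul_smul_comm, add_mul, mul_add, h1, h2]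
  have key' : ∀ a ∈ R.commutant, IsSelfAdjoint a → a * x = x * a := by
    intro a ha hsa
    rcases eq_or_ne a 0 with rfl | h0
    · simp
    have hn : ‖a‖ ≠ 0 := norm_ne_zero_iff.2 h0
    have h1 := key (‖a‖⁻¹ • a) (real_smul_mem ha _)
      (by rw [isSelfAdjoint_iff, star_smul, hsa.star_eq, star_trivial])
      (by rw [norm_smul, norm_inv, norm_norm, inv_mul_cancel₀ hn])
    have h2 : a = ‖a‖ • (‖a‖⁻¹ • a) := by rw [smul_smul, mul_inv_cancel₀ hn, one_smul]
    calc a * x = ‖a‖ • ((‖a‖⁻¹ • a) * x) := by rw [← smul_mul_assoc, ← h2]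
      _ = x * a := by rw [h1, ← mul_smul_comm, ← h2]
  rw [mem_iff_commute_commutant]
  intro u hu
  have h1 := key' (u + star u) (add_mem hu (star_mem hu)) (IsSelfAdjoint.add_star_self u)
  have h2 := key' (Complex.I • (u - star u))
    (complex_smul_mem (sub_mem hu (star_mem hu)) _) (by
      rw [isSelfAdjoint_iff, star_smul, star_sub, star_star]
      simp [sub_eq_neg_add, add_comm])
  rw [smul_mul_assoc, mul_smul_comm] at h2
  have h3 := smul_right_injective _ Complex.I_ne_zero h2
  have h4 : u = (2⁻¹ : ℂ) • ((u + star u) + (u - star u)) := by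
    rw [add_add_sub_cancel, ← two_smul ℂ u, smul_smul]; norm_num
  rw [h4, smul_mul_assoc, mul_smul_comm, add_mul, mul_add, h1, h3]

theorem inner_star_apply_left (t : H →L[ℂ] H) (x y : H) :
    inner ℂ (star t x) y = inner ℂ x (t y) :=
  ContinuousLinearMap.adjoint_inner_left t y x

theorem inner_star_apply_right (t : H →L[ℂ] H) (x y : H) :
    inner ℂ x (star t y) = inner ℂ (t x) y :=
  ContinuousLinearMap.adjoint_inner_right t x y

theorem mul_left_cancel_of_denseRange {b c h : H →L[ℂ] H} (hd : DenseRange h)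
    (hbc : b * h = c * h) : b = c := by
  apply ContinuousLinearMap.coeFn_injective
  refine hd.equalizer b.continuous c.continuous ?_
  ext x
  exact congrArg (fun t : H →L[ℂ] H => t x) hbc

theorem denseRange_iff_star_injective {t : H →L[ℂ] H} :
    DenseRange t ↔ ∀ x, star t x = 0 → x = 0 := by
  constructor
  · intro hd x hx
    refine hd.eq_zero_of_inner_left ℂ fun z => ?_
    rw [← inner_star_apply_left, hx, inner_zero_left]
  · intro h
    have : (LinearMap.range (t : H →ₗ[ℂ] H))ᗮ = ⊥ := by
      rw [Submodule.eq_bot_iff]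
      intro x hx
      apply h
      have := (Submodule.mem_orthogonal _ _).1 hx (t (star t x)) ⟨_, rfl⟩
      rw [← inner_star_apply_right] at this
      exact inner_self_eq_zero.1 this
    have h2 := (Submodule.topologicalClosure_eq_top_iff).2 this
    exact Submodule.dense_iff_topologicalClosure_eq_top.2 h2

/-- Douglas factorization inside a von Neumann algebra. -/
theorem exists_factor_of_norm_le {b c : H →L[ℂ] H} (hb : b ∈ R) (hc : c ∈ R)
    (hbc : ∀ x, ‖b x‖ ≤ ‖c x‖) : ∃ d ∈ R, ‖d‖ ≤ 1 ∧ b = d * c := by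
  set K := (LinearMap.range (c : H →ₗ[ℂ] H)).topologicalClosure with hK
  have hcK : ∀ x, c x ∈ K := fun x => Submodule.le_topologicalClosure _ ⟨x, rfl⟩
  let c' : H →ₗ[ℂ] K := (c : H →ₗ[ℂ] H).codRestrict K hcK
  have hdense : DenseRange c' := by
    intro y
    have hy : (y : H) ∈ closure (Set.range c) := by
      exact y.2
    rw [closure_subtype]
    convert hy using 2
    ext z
    constructor
    · rintro ⟨_, ⟨x, rfl⟩, rfl⟩
      exact ⟨x, rfl⟩
    · rintro ⟨x, rfl⟩
      exact ⟨c' x, ⟨x, rfl⟩, rfl⟩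
  have hbd : ∀ x, ‖(b : H →ₗ[ℂ] H) x‖ ≤ 1 * ‖c' x‖ := fun x => by
    rw [one_mul]; exact hbc x
  let d₀ : K →L[ℂ] H := (b : H →ₗ[ℂ] H).extendOfNorm c'
  have hd₀ : ∀ x, d₀ (c' x) = b x := LinearMap.extendOfNorm_eq hdense ⟨1, hbd⟩
  -- Extending by zero on `Kᗮ` puts `d` in `R`: the commutant is closed under adjoints and leaves
  -- both `K` and `Kᗮ` invariant.
  let d : H →L[ℂ] H := d₀ ∘L K.orthogonalProjectionOnto
  have hdc : ∀ x, d (c x) = b x := fun x => by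
    have : K.orthogonalProjectionOnto (c x) = c' x :=
      Submodule.orthogonalProjectionOnto_mem_subspace_eq_self (c' x)
    change d₀ (K.orthogonalProjectionOnto (c x)) = _
    rw [this, hd₀]
  have hd0 : ∀ y ∈ Kᗮ, d y = 0 := fun y hy => by
    change d₀ (K.orthogonalProjectionOnto y) = _
    rw [Submodule.orthogonalProjectionOnto_apply_of_mem_orthogonal hy, map_zero]
  refine ⟨d, ?_, ?_, ?_⟩
  · rw [mem_iff_commute_commutant]
    intro u hu
    have hcu := fun x => congrArg (fun t : H →L[ℂ] H => t x) (mem_iff_commute_commutant.1 hc u hu)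
    have hbu := fun x => congrArg (fun t : H →L[ℂ] H => t x) (mem_iff_commute_commutant.1 hb u hu)
    have hcu' := fun x => congrArg (fun t : H →L[ℂ] H => t x)
      (mem_iff_commute_commutant.1 hc _ (star_mem hu))
    have h1 : ∀ y ∈ K, u (d y) = d (u y) := by
      intro y hy
      have hcl : IsClosed {y | u (d y) = d (u y)} :=
        isClosed_eq (by fun_prop) (by fun_prop)
      refine closure_minimal ?_ hcl hy
      rintro _ ⟨x, rfl⟩
      change u (d (c x)) = d (u (c x))
      have e1 : u (c x) = c (u x) := hcu x
      have e2 : u (b x) = b (u x) := hbu x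
      rw [hdc, e1, hdc, e2]
    have h2 : ∀ y ∈ Kᗮ, u (d y) = d (u y) := by
      intro y hy
      rw [hd0 y hy, map_zero, hd0]
      rw [hK, Submodule.orthogonal_closure] at hy ⊢
      rw [Submodule.mem_orthogonal] at hy ⊢
      rintro _ ⟨x, rfl⟩
      have e1 : star u (c x) = c (star u x) := hcu' x
      change inner ℂ (c x) (u y) = 0
      rw [← inner_star_apply_left, e1]
      exact hy _ ⟨_, rfl⟩
    ext x
    change u (d x) = d (u x)
    obtain ⟨y, hy, z, hz, rfl⟩ := K.exists_add_mem_mem_orthogonal x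
    simp only [map_add, h1 y hy, h2 z hz]
  · refine ContinuousLinearMap.opNorm_le_bound _ zero_le_one fun x => ?_
    refine (LinearMap.norm_extendOfNorm_apply_le hdense 1 hbd _).trans ?_
    gcongr
    exact K.norm_orthogonalProjectionOnto_apply_le x
  · ext x
    exact (hdc x).symm

/-! ### Isometric columns and their ranges -/

/-- The subspace `{(e x, f x)}` of `H × H`. -/
def pairRange (e f : H →L[ℂ] H) : Submodule ℂ (H × H) :=
  LinearMap.range ((e.prod f : H →L[ℂ] H × H) : H →ₗ[ℂ] H × H)

theorem mem_pairRange {e f : H →L[ℂ] H} {z : H × H} :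
    z ∈ pairRange e f ↔ ∃ x, (e x, f x) = z := Iff.rfl

/-- The column `(e, f)` is an isometry with entries in `R`. -/
structure IsIsometricPair (R : VonNeumannAlgebra H) (e f : H →L[ℂ] H) : Prop where
  fst_mem : e ∈ R
  snd_mem : f ∈ R
  star_mul_add : star e * e + star f * f = 1

namespace IsIsometricPair
variable {e f e' f' : H →L[ℂ] H}

theorem inner_add (h : IsIsometricPair R e f) (x y : H) :
    inner ℂ (e x) (e y) + inner ℂ (f x) (f y) = inner ℂ x y := by
  rw [← inner_star_apply_right, ← inner_star_apply_right, ← _root_.inner_add_right]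
  congr 1
  exact congrArg (fun t : H →L[ℂ] H => t y) h.star_mul_add

theorem norm_sq_add (h : IsIsometricPair R e f) (x : H) :
    ‖e x‖ ^ 2 + ‖f x‖ ^ 2 = ‖x‖ ^ 2 := by
  have := congrArg Complex.re (h.inner_add x x)
  simpa only [inner_self_eq_norm_sq_to_K, Complex.add_re, ← Complex.ofReal_pow,
    Complex.coe_algebraMap, Complex.ofReal_re] using this

theorem isClosed_pairRange (h : IsIsometricPair R e f) :
    IsClosed (pairRange e f : Set (H × H)) := by
  -- `H × H` carries the sup norm `N`, so the column is not isometric for it; but `‖x‖² ≤ 2 N² ≤ (2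
  -- N)²`.
  have : AntilipschitzWith 2 (e.prod f : H →L[ℂ] H × H) := by
    refine AddMonoidHomClass.antilipschitz_of_bound _ fun x => ?_
    have h1 : ‖e x‖ ≤ ‖(e.prod f : H →L[ℂ] H × H) x‖ := norm_fst_le ((e.prod f : H →L[ℂ] H × H) x)
    have h2 : ‖f x‖ ≤ ‖(e.prod f : H →L[ℂ] H × H) x‖ := norm_snd_le ((e.prod f : H →L[ℂ] H × H) x)
    have h3 := h.norm_sq_add x
    generalize ‖(e.prod f : H →L[ℂ] H × H) x‖ = N at *
    have h4 := pow_le_pow_left₀ (norm_nonneg _) h1 2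
    have h5 := pow_le_pow_left₀ (norm_nonneg _) h2 2
    refine abs_le_of_sq_le_sq' ?_ (mul_nonneg zero_le_two ((norm_nonneg _).trans h1)) |>.2
    push_cast
    nlinarith
  exact this.isClosed_range (e.prod f).uniformContinuous

/-- The inclusion gives `e = e' w` and `f = f' w` with `w = e'* e + f'* f` an isometry in `R`.
Finiteness makes `w` surjective. -/
theorem pairRange_eq_of_le (hR : IsFinite R) (h : IsIsometricPair R e f)
    (h' : IsIsometricPair R e' f') (hle : pairRange e f ≤ pairRange e' f') :
    pairRange e f = pairRange e' f' := by
  set w := star e' * e + star f' * f with hw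
  have hwx : ∀ x, e' (w x) = e x ∧ f' (w x) = f x := by
    intro x
    obtain ⟨y, hy⟩ := mem_pairRange.1 (hle ⟨x, rfl⟩ : (e x, f x) ∈ _)
    rw [Prod.mk.injEq] at hy
    have : w x = y := by
      change star e' (e x) + star f' (f x) = y
      rw [← hy.1, ← hy.2]
      exact congrArg (fun t : H →L[ℂ] H => t y) h'.star_mul_add
    rw [this]; exact hy
  have h1 : e' * w = e := ContinuousLinearMap.ext fun x => (hwx x).1
  have h2 : f' * w = f := ContinuousLinearMap.ext fun x => (hwx x).2
  have hwR : w ∈ R := add_mem (mul_mem (star_mem h'.fst_mem) h.fst_mem)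
    (mul_mem (star_mem h'.snd_mem) h.snd_mem)
  have hww : star w * w = 1 := by
    calc star w * w = star w * ((star e' * e' + star f' * f') * w) := by
          rw [h'.star_mul_add, one_mul]
      _ = star (e' * w) * (e' * w) + star (f' * w) * (f' * w) := by
          simp only [star_mul]; noncomm_ring
      _ = 1 := by rw [h1, h2, h.star_mul_add]
  have hww' := hR w hwR hww
  refine le_antisymm hle ?_
  rintro _ ⟨y, rfl⟩
  refine ⟨star w y, ?_⟩
  have : w (star w y) = y := congrArg (fun t : H →L[ℂ] H => t y) hww'
  have h3 := hwx (star w y)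
  rw [this] at h3
  exact Prod.ext h3.1.symm h3.2.symm

end IsIsometricPair

/-- Polar decomposition of an injective column with entries in `R`. -/
theorem exists_isometricPair_mul {c d : H →L[ℂ] H} (hc : c ∈ R) (hd : d ∈ R)
    (hinj : ∀ x, c x = 0 → d x = 0 → x = 0) :
    ∃ e f h : H →L[ℂ] H, IsIsometricPair R e f ∧ h ∈ R ∧ star h = h ∧ DenseRange h ∧
      c = e * h ∧ d = f * h := by
  -- `h = √t` is the modulus of the column, `‖h x‖² = ‖c x‖² + ‖d x‖²`. It is injective with the
  -- column, hence has dense range, being self-adjoint.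
  set t := star c * c + star d * d with ht
  have ht0 : 0 ≤ t := add_nonneg (star_mul_self_nonneg c) (star_mul_self_nonneg d)
  set h := CFC.sqrt t with hh
  have htR : t ∈ R := add_mem (mul_mem (star_mem hc) hc) (mul_mem (star_mem hd) hd)
  have hR : h ∈ R := sqrt_mem htR
  have hs : star h = h := (CFC.sqrt_nonneg t).isSelfAdjoint
  have hhh : h * h = t := CFC.sqrt_mul_sqrt_self t ht0
  have hnorm : ∀ x, ‖c x‖ ^ 2 + ‖d x‖ ^ 2 = ‖h x‖ ^ 2 := by
    intro x
    have h1 : inner ℂ (c x) (c x) + inner ℂ (d x) (d x) = inner ℂ (h x) (h x) := by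
      rw [← inner_star_apply_right, ← inner_star_apply_right, ← inner_star_apply_right,
        ← inner_add_right, hs]
      congr 1
      exact (congrArg (fun t : H →L[ℂ] H => t x) hhh).symm
    have := congrArg Complex.re h1
    simpa only [inner_self_eq_norm_sq_to_K, Complex.add_re, ← Complex.ofReal_pow,
      Complex.coe_algebraMap, Complex.ofReal_re] using this
  have hdense : DenseRange h := by
    rw [denseRange_iff_star_injective, hs]
    intro x hx
    have h1 := hnorm x
    rw [hx, norm_zero] at h1
    have h2 : ‖c x‖ = 0 := by nlinarith [norm_nonneg (c x), norm_nonneg (d x)]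
    have h3 : ‖d x‖ = 0 := by nlinarith [norm_nonneg (c x), norm_nonneg (d x)]
    exact hinj x (norm_eq_zero.1 h2) (norm_eq_zero.1 h3)
  obtain ⟨e, he, -, hce⟩ := exists_factor_of_norm_le hc hR fun x =>
    abs_le_of_sq_le_sq' (by nlinarith [hnorm x, sq_nonneg ‖d x‖]) (norm_nonneg _) |>.2
  obtain ⟨f, hf, -, hdf⟩ := exists_factor_of_norm_le hd hR fun x =>
    abs_le_of_sq_le_sq' (by nlinarith [hnorm x, sq_nonneg ‖c x‖]) (norm_nonneg _) |>.2
  refine ⟨e, f, h, ⟨he, hf, ?_⟩, hR, hs, hdense, hce, hdf⟩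
  have h1 : h * ((star e * e + star f * f) * h) = h * (1 * h) := by
    rw [one_mul, hhh, ht, hce, hdf, star_mul, star_mul, hs]
    noncomm_ring
  -- The right factor `h` cancels directly; taking adjoints moves the left one to the right, where
  -- it cancels too.
  refine mul_left_cancel_of_denseRange hdense (star_injective ?_)
  refine mul_left_cancel_of_denseRange hdense ?_
  have h2 := congrArg star h1
  simpa only [star_mul, hs] using h2

theorem topologicalClosure_pairRange_mul {e f h : H →L[ℂ] H} (hef : IsIsometricPair R e f)
    (hd : DenseRange h) :
    (pairRange (e * h) (f * h)).topologicalClosure = pairRange e f := by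
  refine le_antisymm (Submodule.topologicalClosure_minimal _ ?_ hef.isClosed_pairRange) ?_
  · rintro _ ⟨x, rfl⟩
    exact ⟨h x, rfl⟩
  · rintro _ ⟨x, rfl⟩
    have := (e.prod f).continuous.range_subset_closure_image_dense hd
    refine closure_mono ?_ (this ⟨x, rfl⟩)
    rintro _ ⟨_, ⟨y, rfl⟩, rfl⟩
    exact ⟨y, rfl⟩

/-! ### Injectivity and dense range in a finite algebra -/

/-- Polar decomposition `t* = e h`: `e` is an isometry because `t*` is injective, hence unitary by
finiteness, and `t = h e*` is a product of injective maps. -/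
theorem injective_of_denseRange (hR : IsFinite R) {t : H →L[ℂ] H} (ht : t ∈ R)
    (hd : DenseRange t) (x : H) (hx : t x = 0) : x = 0 := by
  obtain ⟨e, f, h, hef, hhR, hs, hh, hte, hf⟩ := exists_isometricPair_mul (star_mem ht)
    (zero_mem R) fun x hx _ => denseRange_iff_star_injective.1 hd x hx
  have hf0 : f = 0 := mul_left_cancel_of_denseRange hh (by rw [← hf, zero_mul])
  have hee := hef.star_mul_add
  rw [hf0, mul_zero, add_zero] at hee
  have hee' := hR e hef.fst_mem hee
  have ht' : t = h * star e := by rw [← star_star t, hte, star_mul, hs]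
  have h1 : star e x = 0 := by
    refine denseRange_iff_star_injective.1 hh _ ?_
    rw [hs, ← hx, ht']; rfl
  have h2 : e (star e x) = x := congrArg (fun t : H →L[ℂ] H => t x) hee'
  rw [← h2, h1, map_zero]

theorem denseRange_of_injective (hR : IsFinite R) {t : H →L[ℂ] H} (ht : t ∈ R)
    (hi : ∀ x, t x = 0 → x = 0) : DenseRange t := by
  rw [denseRange_iff_star_injective]
  refine injective_of_denseRange hR (star_mem ht) ?_
  rwa [denseRange_iff_star_injective, star_star]

/-! ### Graphs of unbounded operators and affiliation -/

theorem mem_graph_opMul {S T : H →ₗ.[ℂ] H} {x z : H} :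
    (x, z) ∈ (opMul S T).graph ↔ ∃ y, (x, y) ∈ T.graph ∧ (y, z) ∈ S.graph := by
  constructor
  · intro h
    obtain ⟨⟨w, hw, hw'⟩, hx, hz⟩ := LinearPMap.mem_graph_iff _ |>.1 h
    obtain rfl : w = x := hx
    exact ⟨T ⟨w, hw⟩, T.mem_graph ⟨w, hw⟩, by
      have h1 := S.mem_graph ⟨_, hw'⟩
      rwa [show S ⟨_, hw'⟩ = z from hz] at h1⟩
  · rintro ⟨y, hxy, hyz⟩
    obtain ⟨⟨_, hx⟩, rfl, rfl⟩ := LinearPMap.mem_graph_iff _ |>.1 hxy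
    obtain ⟨⟨w, hy⟩, (rfl : w = T ⟨_, hx⟩), rfl⟩ := LinearPMap.mem_graph_iff _ |>.1 hyz
    exact (opMul S T).mem_graph ⟨_, hx, hy⟩

theorem mem_graph_ofBounded {C : H →L[ℂ] H} {x y : H} :
    (x, y) ∈ (ofBounded C).graph ↔ C x = y := by
  rw [LinearPMap.mem_graph_iff]
  constructor
  · rintro ⟨w, rfl, h⟩
    exact h
  · rintro h
    exact ⟨⟨x, trivial⟩, rfl, h⟩

theorem mem_graph_sub {S T : H →ₗ.[ℂ] H} {x z : H} :
    (x, z) ∈ (S - T).graph ↔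
      ∃ y y', (x, y) ∈ S.graph ∧ (x, y') ∈ T.graph ∧ z = y - y' := by
  constructor
  · intro h
    obtain ⟨⟨w, hS, hT⟩, hx, hz⟩ := LinearPMap.mem_graph_iff _ |>.1 h
    obtain rfl : w = x := hx
    exact ⟨_, _, S.mem_graph ⟨w, hS⟩, T.mem_graph ⟨w, hT⟩, hz.symm⟩
  · rintro ⟨y, y', hS, hT, rfl⟩
    obtain ⟨⟨_, hx⟩, rfl, rfl⟩ := LinearPMap.mem_graph_iff _ |>.1 hS
    obtain ⟨⟨_, hx'⟩, h1, rfl⟩ := LinearPMap.mem_graph_iff _ |>.1 hT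
    obtain rfl := h1
    exact (S - T).mem_graph ⟨_, hx, hx'⟩

theorem mem_graph_adjoint {T : H →ₗ.[ℂ] H} (hT : Dense (T.domain : Set H)) {y z : H} :
    (y, z) ∈ T†.graph ↔ ∀ a b, (a, b) ∈ T.graph → inner ℂ b y = inner ℂ a z := by
  rw [LinearPMap.adjoint_graph_eq_graph_adjoint hT, Submodule.mem_adjoint_iff]
  simp only [sub_eq_zero]

theorem closure_eq_of_isClosed {T : H →ₗ.[ℂ] H} (hT : T.IsClosed) : T.closure = T := by
  refine LinearPMap.eq_of_eq_graph ?_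
  rw [← hT.isClosable.graph_closure_eq_closure_graph]
  exact hT.submodule_topologicalClosure_eq

theorem unitary_apply_star_apply {u : H →L[ℂ] H} (hu : u ∈ unitary (H →L[ℂ] H)) (x : H) :
    u (star u x) = x :=
  congrArg (fun t : H →L[ℂ] H => t x) (Unitary.mem_iff.1 hu).2

theorem unitary_star_apply_apply {u : H →L[ℂ] H} (hu : u ∈ unitary (H →L[ℂ] H)) (x : H) :
    star u (u x) = x :=
  congrArg (fun t : H →L[ℂ] H => t x) (Unitary.mem_iff.1 hu).1

/-- The graph of `T` is invariant under the unitaries of the commutant of `R`. -/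
def IsInvariantGraph (R : VonNeumannAlgebra H) (T : H →ₗ.[ℂ] H) : Prop :=
  ∀ u ∈ R.commutant, u ∈ unitary (H →L[ℂ] H) → ∀ x y, (x, y) ∈ T.graph → (u x, u y) ∈ T.graph

theorem IsAffiliated.isInvariantGraph {T : H →ₗ.[ℂ] H} (hT : IsAffiliated R T) :
    IsInvariantGraph R T := by
  intro u hu hu' x y hxy
  rw [← hT.conj_eq u hu hu', mem_graph_opMul] at hxy
  obtain ⟨w, hw, hwy⟩ := hxy
  obtain ⟨v, hv, hvw⟩ := mem_graph_opMul.1 hw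
  rw [mem_graph_ofBounded] at hv hwy
  rw [← hwy, unitary_apply_star_apply hu', hv]
  exact hvw

theorem IsInvariantGraph.isAffiliated {T : H →ₗ.[ℂ] H} (hT : IsInvariantGraph R T)
    (hd : Dense (T.domain : Set H)) (hc : T.IsClosed) : IsAffiliated R T := by
  refine ⟨hd, hc, fun u hu hu' => LinearPMap.eq_of_eq_graph ?_⟩
  ext ⟨x, y⟩
  rw [mem_graph_opMul]
  constructor
  · rintro ⟨w, hw, hwy⟩
    obtain ⟨v, hv, hvw⟩ := mem_graph_opMul.1 hw
    rw [mem_graph_ofBounded] at hv hwy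
    have := hT _ (star_mem hu) (Unitary.star_mem hu') _ _ hvw
    rwa [← hv, unitary_star_apply_apply hu', hwy] at this
  · intro h
    exact ⟨u y, mem_graph_opMul.2 ⟨u x, mem_graph_ofBounded.2 rfl, hT u hu hu' x y h⟩,
      mem_graph_ofBounded.2 (unitary_star_apply_apply hu' y)⟩

theorem IsInvariantGraph.adjoint {T : H →ₗ.[ℂ] H} (hT : IsInvariantGraph R T)
    (hd : Dense (T.domain : Set H)) : IsInvariantGraph R T† := by
  intro u hu hu' x y hxy
  rw [mem_graph_adjoint hd] at hxy ⊢
  intro a b hab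
  rw [← inner_star_apply_left, ← inner_star_apply_left]
  exact hxy _ _ (hT _ (star_mem hu) (Unitary.star_mem hu') _ _ hab)

theorem IsInvariantGraph.opMul {S T : H →ₗ.[ℂ] H} (hS : IsInvariantGraph R S)
    (hT : IsInvariantGraph R T) : IsInvariantGraph R (opMul S T) := by
  intro u hu hu' x z hxz
  obtain ⟨y, hy, hyz⟩ := mem_graph_opMul.1 hxz
  exact mem_graph_opMul.2 ⟨u y, hT u hu hu' _ _ hy, hS u hu hu' _ _ hyz⟩

/-! ### Affiliated operators as isometric columns -/

/-- The first column of the orthogonal projection of `H ⊕ H` onto the graph of a closed operator. -/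
theorem exists_graph_projection {T : H →ₗ.[ℂ] H} (hT : T.IsClosed) :
    ∃ a b : H →L[ℂ] H, ∀ x, (a x, b x) ∈ T.graph ∧
      ∀ p q, (p, q) ∈ T.graph → inner ℂ p (a x) + inner ℂ q (b x) = inner ℂ p x := by
  -- The sup norm on `H × H` is not Hilbertian, so the projection is taken in the `ℓ²` sum.
  let L := WithLp.prodContinuousLinearEquiv 2 ℂ H H
  let K : Submodule ℂ (WithLp 2 (H × H)) := T.graph.comap (L : WithLp 2 (H × H) →ₗ[ℂ] H × H)
  have hK : IsClosed (K : Set (WithLp 2 (H × H))) := IsClosed.preimage L.continuous hT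
  have : CompleteSpace K := hK.completeSpace_coe
  let X : H →L[ℂ] WithLp 2 (H × H) :=
    K.starProjection ∘L (L.symm : H × H →L[ℂ] WithLp 2 (H × H)) ∘L ContinuousLinearMap.inl ℂ H H
  refine ⟨ContinuousLinearMap.fst ℂ H H ∘L (L : WithLp 2 (H × H) →L[ℂ] H × H) ∘L X,
    ContinuousLinearMap.snd ℂ H H ∘L (L : WithLp 2 (H × H) →L[ℂ] H × H) ∘L X, fun x => ⟨?_, ?_⟩⟩
  · exact (K.starProjection_apply_mem (L.symm (x, 0)) : L (X x) ∈ T.graph)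
  · intro p q hpq
    have hmem : WithLp.toLp 2 (p, q) ∈ K := hpq
    have h1 := K.sub_starProjection_mem_orthogonal (L.symm (x, 0)) _ hmem
    rw [inner_sub_right, sub_eq_zero, WithLp.prod_inner_apply, WithLp.prod_inner_apply] at h1
    have h2 : inner ℂ p x + inner ℂ q 0 = inner ℂ p (X x).fst + inner ℂ q (X x).snd := h1
    rw [inner_zero_right, add_zero] at h2
    exact h2.symm

theorem eq_zero_of_inner_domain {T : H →ₗ.[ℂ] H} (hd : Dense (T.domain : Set H)) {w : H}
    (h : ∀ p q, (p, q) ∈ T.graph → inner ℂ p w = 0) : w = 0 :=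
  hd.eq_zero_of_inner_right ℂ fun p hp => h p _ (T.mem_graph ⟨p, hp⟩)

/-- The first column `(a, b)` of the graph projection is unique, so it commutes with the unitaries
of the commutant and has entries in `R`. It is injective because `T` is densely defined, and `(e,
f)` is the isometric part of its polar decomposition. -/
theorem IsAffiliated.exists_graph_eq_pairRange {T : H →ₗ.[ℂ] H} (hT : IsAffiliated R T) :
    ∃ e f, IsIsometricPair R e f ∧ T.graph = pairRange e f := by
  obtain ⟨a, b, hab⟩ := exists_graph_projection hT.isClosed
  have huniq : ∀ x p q, (p, q) ∈ T.graph → (∀ p' q', (p', q') ∈ T.graph →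
      inner ℂ p' p + inner ℂ q' q = inner ℂ p' x) → p = a x ∧ q = b x := by
    intro x p q hpq h
    have h1 := T.graph.sub_mem hpq (hab x).1
    have h2 : inner ℂ (p - a x) p + inner ℂ (q - b x) q = inner ℂ (p - a x) x := h _ _ h1
    rw [← (hab x).2 _ _ h1, ← sub_eq_zero, add_sub_add_comm, ← inner_sub_right,
      ← inner_sub_right, inner_self_eq_norm_sq_to_K, inner_self_eq_norm_sq_to_K] at h2
    have h3 : ‖p - a x‖ ^ 2 + ‖q - b x‖ ^ 2 = 0 := by
      simpa only [Complex.add_re, ← Complex.ofReal_pow, Complex.coe_algebraMap,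
        Complex.ofReal_re, Complex.zero_re] using congrArg Complex.re h2
    have h4 : ‖p - a x‖ = 0 := by nlinarith [norm_nonneg (p - a x), sq_nonneg ‖q - b x‖]
    have h5 : ‖q - b x‖ = 0 := by nlinarith [norm_nonneg (q - b x), sq_nonneg ‖p - a x‖]
    exact ⟨sub_eq_zero.1 (norm_eq_zero.1 h4), sub_eq_zero.1 (norm_eq_zero.1 h5)⟩
  have hinv := hT.isInvariantGraph
  have hcomm : ∀ u ∈ R.commutant, u ∈ unitary (H →L[ℂ] H) → ∀ x,
      u (a x) = a (u x) ∧ u (b x) = b (u x) := by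
    intro u hu hu' x
    refine huniq _ _ _ (hinv u hu hu' _ _ (hab x).1) fun p q hpq => ?_
    rw [← inner_star_apply_left u, ← inner_star_apply_left u, ← inner_star_apply_left u]
    exact (hab x).2 _ _ (hinv _ (star_mem hu) (Unitary.star_mem hu') _ _ hpq)
  have ha : a ∈ R := mem_of_commute_unitary fun u hu hu' =>
    ContinuousLinearMap.ext fun x => (hcomm u hu hu' x).1
  have hb : b ∈ R := mem_of_commute_unitary fun u hu hu' =>
    ContinuousLinearMap.ext fun x => (hcomm u hu hu' x).2
  obtain ⟨e, f, h, hef, -, -, hd, hae, hbf⟩ := exists_isometricPair_mul ha hb fun x h1 h2 =>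
    eq_zero_of_inner_domain hT.dense_domain fun p q hpq => by
      rw [← (hab x).2 p q hpq, h1, h2, inner_zero_right, inner_zero_right, add_zero]
  have hle : pairRange e f ≤ T.graph := by
    rw [← topologicalClosure_pairRange_mul hef hd, ← hae, ← hbf]
    refine Submodule.topologicalClosure_minimal _ ?_ hT.isClosed
    rintro _ ⟨x, rfl⟩
    exact (hab x).1
  refine ⟨e, f, hef, le_antisymm ?_ hle⟩
  rintro ⟨p, q⟩ hpq
  -- `(e y, f y)` is the orthogonal projection of `(p, q)` onto the range of the column. The
  -- remainder is orthogonal to every `(a x, b x)`, so its first coordinate vanishes, and then so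
  -- does the second, since the remainder lies in a graph.
  set y := star e p + star f q with hy
  have h1 : (p - e y, q - f y) ∈ T.graph := T.graph.sub_mem hpq (hle ⟨y, rfl⟩)
  have h2 : star e (p - e y) + star f (q - f y) = 0 := by
    have : star e (e y) + star f (f y) = y :=
      congrArg (fun t : H →L[ℂ] H => t y) hef.star_mul_add
    rw [map_sub, map_sub, sub_add_sub_comm, this, sub_self]
  have h3 : p - e y = 0 := by
    refine ext_inner_right ℂ fun x => ?_
    rw [← (hab x).2 _ _ h1, hae, hbf, inner_zero_left]
    change inner ℂ (p - e y) (e (h x)) + inner ℂ (q - f y) (f (h x)) = 0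
    rw [← inner_star_apply_left e, ← inner_star_apply_left f, ← inner_add_left, h2, inner_zero_left]
  have h4 := T.graph_fst_eq_zero_snd h1 h3
  exact ⟨y, Prod.ext (sub_eq_zero.1 h3).symm (sub_eq_zero.1 h4).symm⟩

theorem denseRange_of_graph_eq_pairRange {T : H →ₗ.[ℂ] H} (hd : Dense (T.domain : Set H))
    {e f : H →L[ℂ] H} (h : T.graph = pairRange e f) : DenseRange e := by
  refine hd.mono fun x hx => ?_
  have h1 := T.mem_graph ⟨x, hx⟩
  rw [h] at h1
  obtain ⟨y, hy⟩ := mem_pairRange.1 h1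
  exact ⟨y, congrArg Prod.fst hy⟩

/-! ### Self-adjointness of `T† T` -/

/-- A symmetric operator `S` is self-adjoint if `S + l` and its conjugate are surjective. -/
theorem isSelfAdjoint_of_surjective {S : H →ₗ.[ℂ] H} (hd : Dense (S.domain : Set H))
    (hsymm : ∀ x y x' y', (x, y) ∈ S.graph → (x', y') ∈ S.graph → inner ℂ y x' = inner ℂ x y')
    (l : ℂ) (h₁ : ∀ z, ∃ x y, (x, y) ∈ S.graph ∧ y + l • x = z)
    (h₂ : ∀ z, ∃ x y, (x, y) ∈ S.graph ∧ y + (starRingEnd ℂ l) • x = z) :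
    IsSelfAdjoint S := by
  refine LinearPMap.isSelfAdjoint_def.2 (LinearPMap.eq_of_eq_graph (le_antisymm ?_ ?_))
  · rintro ⟨u, v⟩ huv
    obtain ⟨x, y, hxy, h⟩ := h₁ (v + l • u)
    rw [mem_graph_adjoint hd] at huv
    have h3 : v - y = -(l • (u - x)) := by
      rw [smul_sub, neg_sub, sub_eq_sub_iff_add_eq_add, ← h, add_comm]
    -- `u - x` is orthogonal to the range of `S + conj l`, which is all of `H`.
    have h4 : u - x = 0 := by
      refine ext_inner_left ℂ fun z => ?_
      obtain ⟨a, b, hab, rfl⟩ := h₂ z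
      rw [inner_zero_right, inner_add_left, inner_smul_left, Complex.conj_conj, inner_sub_right,
        huv a b hab, hsymm a b x y hab hxy, ← inner_sub_right, h3, inner_neg_right,
        inner_smul_right, neg_add_cancel]
    rw [h4, smul_zero, neg_zero] at h3
    rwa [sub_eq_zero.1 h4, sub_eq_zero.1 h3]
  · rintro ⟨x, y⟩ hxy
    rw [mem_graph_adjoint hd]
    exact fun a b hab => hsymm a b x y hab hxy

section AdjointMul
variable {T : H →ₗ.[ℂ] H} {c d : H →L[ℂ] H}

theorem inner_of_mem_graph_adjoint_opMul (hd : Dense (T.domain : Set H)) {x y z x' y' : H}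
    (hxy : (x, y) ∈ (opMul T† T).graph) (h' : (x', y') ∈ T.graph) (h : (x, z) ∈ T.graph) :
    inner ℂ y x' = inner ℂ z y' := by
  obtain ⟨w, hw, hwy⟩ := mem_graph_opMul.1 hxy
  obtain rfl := T.mem_graph_snd_inj hw h rfl
  rw [← inner_conj_symm, ← (mem_graph_adjoint hd).1 hwy x' y' h', inner_conj_symm]

theorem adjoint_opMul_symmetric (hd : Dense (T.domain : Set H)) {x y x' y' : H}
    (hxy : (x, y) ∈ (opMul T† T).graph) (hxy' : (x', y') ∈ (opMul T† T).graph) :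
    inner ℂ y x' = inner ℂ x y' := by
  obtain ⟨w, hw, -⟩ := mem_graph_opMul.1 hxy
  obtain ⟨w', hw', -⟩ := mem_graph_opMul.1 hxy'
  rw [inner_of_mem_graph_adjoint_opMul hd hxy hw' hw, ← inner_conj_symm x,
    inner_of_mem_graph_adjoint_opMul hd hxy' hw hw', inner_conj_symm]

/-- In effect `c c* = (1 + T† T)⁻¹`. Here `T (c c* x) = d c* x`, and `c* c + d* d = 1` gives `⟨d w,
d c* x⟩ = ⟨c w, x - c c* x⟩`. -/
theorem IsIsometricPair.mem_graph_adjoint_opMul (hcd : IsIsometricPair R c d)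
    (hT : T.graph = pairRange c d) (hd : Dense (T.domain : Set H)) (x : H) :
    (c (star c x), x - c (star c x)) ∈ (opMul T† T).graph := by
  refine mem_graph_opMul.2 ⟨d (star c x), hT ▸ ⟨star c x, rfl⟩, ?_⟩
  rw [mem_graph_adjoint hd]
  intro p q hpq
  rw [hT] at hpq
  obtain ⟨w, hw⟩ := mem_pairRange.1 hpq
  obtain ⟨rfl, rfl⟩ := Prod.mk.inj hw
  rw [inner_sub_right, ← inner_star_apply_right c w x, ← hcd.inner_add w, add_sub_cancel_left]

theorem mul_star_injective (hc : DenseRange c) (x : H) (hx : c (star c x) = 0) : x = 0 := by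
  refine denseRange_iff_star_injective.1 hc x ?_
  rw [← inner_self_eq_zero (𝕜 := ℂ), inner_star_apply_left, hx, inner_zero_right]

theorem denseRange_mul_star (hc : DenseRange c) : DenseRange (c * star c) := by
  rw [denseRange_iff_star_injective, star_mul, star_star]
  exact mul_star_injective hc

theorem dense_domain_of_denseRange {S : H →ₗ.[ℂ] H} {m n : H →L[ℂ] H} (hm : DenseRange m)
    (h : ∀ x, (m x, n x) ∈ S.graph) : Dense (S.domain : Set H) := by
  refine Dense.mono ?_ hm
  rintro _ ⟨x, rfl⟩
  exact LinearPMap.mem_domain_of_mem_graph (h x)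

/-- Since `c c*` provides preimages under `1 + T† T`, the surjectivity criterion applies with `l =
1`. -/
theorem IsAffiliated.isSelfAdjoint_adjoint_opMul (hT : IsAffiliated R T) :
    IsSelfAdjoint (MurrayVonNeumann.opMul T† T) := by
  obtain ⟨c, d, hcd, hg⟩ := hT.exists_graph_eq_pairRange
  have hmem := hcd.mem_graph_adjoint_opMul hg hT.dense_domain
  have hc := denseRange_of_graph_eq_pairRange hT.dense_domain hg
  refine isSelfAdjoint_of_surjective
    (dense_domain_of_denseRange (n := 1 - c * star c) (denseRange_mul_star hc) hmem)
    (fun x y x' y' h h' => adjoint_opMul_symmetric hT.dense_domain h h') 1 ?_ ?_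
  · exact fun z => ⟨_, _, hmem z, by rw [one_smul, sub_add_cancel]⟩
  · exact fun z => ⟨_, _, hmem z, by rw [map_one, one_smul, sub_add_cancel]⟩

theorem IsAffiliated.adjoint_opMul (hT : IsAffiliated R T) :
    IsAffiliated R (MurrayVonNeumann.opMul T† T) :=
  ((hT.isInvariantGraph.adjoint hT.dense_domain).opMul hT.isInvariantGraph).isAffiliated
    hT.isSelfAdjoint_adjoint_opMul.dense_domain hT.isSelfAdjoint_adjoint_opMul.isClosed

theorem IsAffiliated.strongMul_adjoint_self (hT : IsAffiliated R T) :
    strongMul T† T = MurrayVonNeumann.opMul T† T :=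
  closure_eq_of_isClosed hT.isSelfAdjoint_adjoint_opMul.isClosed

end AdjointMul

/-! ### Common domains, cores and essential self-adjointness in a finite algebra -/

/-- In a finite von Neumann algebra, the ranges of two operators with dense range have a dense
intersection. -/
theorem exists_denseRange_common_multiple (hR : IsFinite R) {a b : H →L[ℂ] H} (ha : a ∈ R)
    (hb : b ∈ R) (hda : DenseRange a) (hdb : DenseRange b) :
    ∃ p q, p ∈ R ∧ q ∈ R ∧ a * p = b * q ∧ DenseRange (a * p) := by
  have hsa := denseRange_iff_star_injective.1 hda
  obtain ⟨e, f, h, hef, hhR, hs, hh, hae, hbf⟩ := exists_isometricPair_mul (star_mem ha)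
    (star_mem hb) fun x hx _ => hsa x hx
  have ha' : a = h * star e := by rw [← star_star a, hae, star_mul, hs]
  have hb' : b = h * star f := by rw [← star_star b, hbf, star_mul, hs]
  have hdf : DenseRange f := by
    have h1 : DenseRange (f * h) := by
      rw [← hbf, denseRange_iff_star_injective, star_star]
      exact injective_of_denseRange hR hb hdb
    refine h1.mono ?_
    rintro _ ⟨x, rfl⟩
    exact ⟨h x, rfl⟩
  have hde : DenseRange e := by
    have h1 : DenseRange (e * h) := by
      rw [← hae, denseRange_iff_star_injective, star_star]
      exact injective_of_denseRange hR ha hda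
    refine h1.mono ?_
    rintro _ ⟨x, rfl⟩
    exact ⟨h x, rfl⟩
  have hfR := mul_mem hef.snd_mem (star_mem hef.fst_mem)
  -- From `a = h e*` and `b = h f*`, both sides equal `h f* f e*` because `1 - e* e = f* f`.
  have heq : a * (1 - e * star e) = b * (f * star e) := by
    have h1 : star f * f = 1 - star e * e := eq_sub_of_add_eq' hef.star_mul_add
    calc a * (1 - e * star e) = h * (1 - star e * e) * star e := by rw [ha']; noncomm_ring
      _ = b * (f * star e) := by rw [← h1, hb']; noncomm_ring
  refine ⟨1 - e * star e, f * star e,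
    sub_mem (one_mem R) (mul_mem hef.fst_mem (star_mem hef.fst_mem)), hfR, heq, ?_⟩
  rw [heq]
  refine denseRange_of_injective hR (mul_mem hb hfR) fun x hx => ?_
  exact denseRange_iff_star_injective.1 hde x (injective_of_denseRange hR hef.snd_mem hdf _
    (injective_of_denseRange hR hb hdb _ hx))

section Common
variable {A B : H →ₗ.[ℂ] H}

/-- A dense subspace, parametrized in `R`, on which `A`, `B`, `A† A` and `B† B` are defined. -/
theorem exists_common_domain (hR : IsFinite R) (hA : IsAffiliated R A) (hB : IsAffiliated R B) :
    ∃ m nA nB rA rB : H →L[ℂ] H, m ∈ R ∧ nA ∈ R ∧ nB ∈ R ∧ rA ∈ R ∧ rB ∈ R ∧ DenseRange m ∧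
      (∀ x, (m x, nA x) ∈ A.graph) ∧ (∀ x, (m x, nB x) ∈ B.graph) ∧
      (∀ x, (m x, rA x) ∈ (opMul A† A).graph) ∧ (∀ x, (m x, rB x) ∈ (opMul B† B).graph) := by
  obtain ⟨c, d, hcd, hgA⟩ := hA.exists_graph_eq_pairRange
  obtain ⟨c', d', hcd', hgB⟩ := hB.exists_graph_eq_pairRange
  have hc := denseRange_of_graph_eq_pairRange hA.dense_domain hgA
  have hc' := denseRange_of_graph_eq_pairRange hB.dense_domain hgB
  have haR := mul_mem hcd.fst_mem (star_mem hcd.fst_mem)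
  have hbR := mul_mem hcd'.fst_mem (star_mem hcd'.fst_mem)
  obtain ⟨p, q, hp, hq, hpq, hd⟩ := exists_denseRange_common_multiple hR haR hbR
    (denseRange_mul_star hc) (denseRange_mul_star hc')
  have hx : ∀ x, c (star c (p x)) = c' (star c' (q x)) := fun x =>
    congrArg (fun t : H →L[ℂ] H => t x) hpq
  refine ⟨c * star c * p, d * star c * p, d' * star c' * q, p - c * star c * p,
    q - c * star c * p, mul_mem haR hp,
    mul_mem (mul_mem hcd.snd_mem (star_mem hcd.fst_mem)) hp,
    mul_mem (mul_mem hcd'.snd_mem (star_mem hcd'.fst_mem)) hq,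
    sub_mem hp (mul_mem haR hp), sub_mem hq (mul_mem haR hp), hd, fun x => ?_, fun x => ?_,
    fun x => ?_, fun x => ?_⟩
  · rw [hgA]
    exact ⟨star c (p x), rfl⟩
  · rw [hgB]
    exact ⟨star c' (q x), Prod.ext (hx x).symm rfl⟩
  · exact hcd.mem_graph_adjoint_opMul hgA hA.dense_domain (p x)
  · have h1 := hcd'.mem_graph_adjoint_opMul hgB hB.dense_domain (q x)
    rw [← hx] at h1
    exact h1

end Common

/-- In a finite von Neumann algebra, a densely defined subspace of the graph of an affiliated
operator that is parametrized by `R` is a core. -/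
theorem topologicalClosure_pairRange_eq_of_le (hR : IsFinite R) {m n e f : H →L[ℂ] H}
    (hm : m ∈ R) (hn : n ∈ R) (hd : DenseRange m) (hef : IsIsometricPair R e f)
    (hle : pairRange m n ≤ pairRange e f) :
    (pairRange m n).topologicalClosure = pairRange e f := by
  obtain ⟨e', f', h, hef', -, -, hh, rfl, rfl⟩ := exists_isometricPair_mul hm hn
    fun x hx _ => injective_of_denseRange hR hm hd x hx
  rw [topologicalClosure_pairRange_mul hef' hh]
  refine hef'.pairRange_eq_of_le hR hef ?_
  rw [← topologicalClosure_pairRange_mul hef' hh]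
  exact Submodule.topologicalClosure_minimal _ hle hef.isClosed_pairRange

/-- In a finite von Neumann algebra, a closable symmetric operator whose graph contains a densely
defined subspace that is parametrized by `R` is essentially self-adjoint. -/
theorem isSelfAdjoint_closure_of_symmetric (hR : IsFinite R) {S : H →ₗ.[ℂ] H}
    {m n : H →L[ℂ] H} (hm : m ∈ R) (hn : n ∈ R) (hd : DenseRange m)
    (hmn : ∀ x, (m x, n x) ∈ S.graph)
    (hsymm : ∀ x y x' y', (x, y) ∈ S.graph → (x', y') ∈ S.graph → inner ℂ y x' = inner ℂ x y') :
    S.IsClosable ∧ IsSelfAdjoint S.closure := by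
  have hSd := dense_domain_of_denseRange hd hmn
  have hcl : S.IsClosable := by
    refine LinearPMap.isClosable_iff_exists_closed_extension.2
      ⟨S†, LinearPMap.adjoint_isClosed hSd, LinearPMap.le_of_le_graph ?_⟩
    rintro ⟨x, y⟩ hxy
    rw [mem_graph_adjoint hSd]
    exact fun a b hab => hsymm a b x y hab hxy
  have hg := hcl.graph_closure_eq_closure_graph
  have hsymm₁ : ∀ x y x' y', (x, y) ∈ S.graph → (x', y') ∈ S.closure.graph →
      inner ℂ y x' = inner ℂ x y' := by
    intro x y x' y' h h'
    rw [← hg] at h'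
    have hc : IsClosed {z : H × H | inner ℂ y z.1 = inner ℂ x z.2} :=
      isClosed_eq (by fun_prop) (by fun_prop)
    exact closure_minimal (fun z hz => hsymm x y z.1 z.2 h hz) hc h'
  have hsymm₂ : ∀ x y x' y', (x, y) ∈ S.closure.graph → (x', y') ∈ S.closure.graph →
      inner ℂ y x' = inner ℂ x y' := by
    intro x y x' y' h h'
    rw [← hg] at h
    have hc : IsClosed {z : H × H | inner ℂ z.2 x' = inner ℂ z.1 y'} :=
      isClosed_eq (by fun_prop) (by fun_prop)
    exact closure_minimal (fun z hz => hsymm₁ z.1 z.2 x' y' hz h') hc h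
  refine ⟨hcl, ?_⟩
  obtain ⟨e, f, h, hef, -, -, hh, rfl, rfl⟩ := exists_isometricPair_mul hm hn
    fun x hx _ => injective_of_denseRange hR hm hd x hx
  have hmem : ∀ x, (e x, f x) ∈ S.closure.graph := by
    have hle : (pairRange (e * h) (f * h)).topologicalClosure ≤ S.closure.graph := by
      rw [← hg]
      refine Submodule.topologicalClosure_mono ?_
      rintro _ ⟨x, rfl⟩
      exact hmn x
    rw [topologicalClosure_pairRange_mul hef hh] at hle
    exact fun x => hle ⟨x, rfl⟩
  have hfe : star f * e = star e * f := by
    ext x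
    refine ext_inner_left ℂ fun y => ?_
    change inner ℂ y (star f (e x)) = inner ℂ y (star e (f x))
    rw [inner_star_apply_right, inner_star_apply_right]
    exact hsymm₂ _ _ _ _ (hmem y) (hmem x)
  -- For `l = ±i` the symmetry relation `f* e = e* f` cancels the cross terms, so `f + l e` is an
  -- isometry of `R`, hence onto by finiteness. It maps `z` to the value of `S.closure + l` at `e
  -- z`.
  have hsurj : ∀ l : ℂ, star l = -l → star l * l = 1 →
      ∀ z, ∃ x y, (x, y) ∈ S.closure.graph ∧ y + l • x = z := by
    intro l hl hl' z
    have hw : star (f + l • e) * (f + l • e) = 1 := by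
      rw [star_add, star_smul, add_mul, mul_add, mul_add, smul_mul_smul_comm, hl', one_smul,
        smul_mul_assoc, mul_smul_comm, hfe, hl, neg_smul, ← hef.star_mul_add]
      abel
    have hw' := hR _ (add_mem hef.snd_mem (complex_smul_mem hef.fst_mem l)) hw
    exact ⟨_, _, hmem (star (f + l • e) z), congrArg (fun t : H →L[ℂ] H => t z) hw'⟩
  refine isSelfAdjoint_of_surjective (hSd.mono S.le_closure.1) hsymm₂ Complex.I
    (hsurj _ (by simp) (by simp)) (hsurj _ (by simp) (by simp))

/-! ### The two implications -/

/-- The quadratic form of `B† B - A† A` at `x` is `‖B x‖² - ‖A x‖²`. -/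
theorem re_inner_adjoint_opMul_sub {A B : H →ₗ.[ℂ] H} (hA : Dense (A.domain : Set H))
    (hB : Dense (B.domain : Set H)) {x a b y z : H} (ha : (x, a) ∈ A.graph)
    (hb : (x, b) ∈ B.graph) (hy : (x, y) ∈ (opMul A† A).graph)
    (hz : (x, z) ∈ (opMul B† B).graph) :
    (inner ℂ (z - y) x).re = ‖b‖ ^ 2 - ‖a‖ ^ 2 := by
  rw [inner_sub_left, inner_of_mem_graph_adjoint_opMul hA hy ha ha,
    inner_of_mem_graph_adjoint_opMul hB hz hb hb, inner_self_eq_norm_sq_to_K,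
    inner_self_eq_norm_sq_to_K, Complex.sub_re]
  norm_cast

theorem exists_eq_strongMul_of_affLE (hR : IsFinite R) {A B : H →ₗ.[ℂ] H}
    (hA : IsAffiliated R A) (hB : IsAffiliated R B)
    (h : AffLE R (strongMul A† A) (strongMul B† B)) :
    ∃ C ∈ R, ‖C‖ ≤ 1 ∧ A = strongMul (ofBounded C) B := by
  obtain ⟨m, nA, nB, rA, rB, hm, hnA, hnB, -, -, hd, hgA, hgB, hrA, hrB⟩ :=
    exists_common_domain hR hA hB
  have hpos := h.positive_sub.2
  rw [hA.strongMul_adjoint_self, hB.strongMul_adjoint_self] at hpos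
  have hnorm : ∀ x, ‖nA x‖ ≤ ‖nB x‖ := by
    intro x
    have h1 : (m x, rB x - rA x) ∈ (strongSub (opMul B† B) (opMul A† A)).graph :=
      LinearPMap.le_graph_of_le (LinearPMap.le_closure _)
        (mem_graph_sub.2 ⟨_, _, hrB x, hrA x, rfl⟩)
    obtain ⟨w, hw, hw'⟩ := (LinearPMap.mem_graph_iff _).1 h1
    have h2 := hpos w
    rw [hw, hw', re_inner_adjoint_opMul_sub hA.dense_domain hB.dense_domain (hgA x) (hgB x)
      (hrA x) (hrB x), sub_nonneg] at h2
    exact abs_le_of_sq_le_sq' h2 (norm_nonneg _) |>.2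
  obtain ⟨C, hC, hC1, hCn⟩ := exists_factor_of_norm_le hnA hnB hnorm
  refine ⟨C, hC, hC1, ?_⟩
  obtain ⟨c, d, hcd, hA'⟩ := hA.exists_graph_eq_pairRange
  obtain ⟨c', d', hcd', hB'⟩ := hB.exists_graph_eq_pairRange
  have hcore : (pairRange m nA).topologicalClosure = A.graph := by
    rw [hA']
    refine topologicalClosure_pairRange_eq_of_le hR hm hnA hd hcd ?_
    rw [← hA']
    rintro _ ⟨x, rfl⟩
    exact hgA x
  have hCB : (opMul (ofBounded C) B).graph = pairRange c' (C * d') := by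
    ext ⟨x, z⟩
    simp only [mem_graph_opMul, mem_graph_ofBounded, hB', mem_pairRange, Prod.mk.injEq]
    constructor
    · rintro ⟨_, ⟨w, rfl, rfl⟩, rfl⟩
      exact ⟨w, rfl, rfl⟩
    · rintro ⟨w, rfl, rfl⟩
      exact ⟨_, ⟨w, rfl, rfl⟩, rfl⟩
  have hmCB : pairRange m nA ≤ (opMul (ofBounded C) B).graph := by
    rintro _ ⟨x, rfl⟩
    exact mem_graph_opMul.2 ⟨_, hgB x, mem_graph_ofBounded.2
      (congrArg (fun t : H →L[ℂ] H => t x) hCn).symm⟩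
  have hc' := denseRange_of_graph_eq_pairRange hB.dense_domain hB'
  obtain ⟨e, f, g, hef, -, -, hg, hce, hdf⟩ := exists_isometricPair_mul hcd'.fst_mem
    (mul_mem hC hcd'.snd_mem) fun x hx _ => injective_of_denseRange hR hcd'.fst_mem hc' x hx
  -- This closure is not yet known to be a graph. Being the range of an isometric pair is enough for
  -- the core argument, and its equality with the graph of `A` then proves that `C B` is closable.
  have hcl : (opMul (ofBounded C) B).graph.topologicalClosure = pairRange e f := by
    rw [hCB, hce, hdf, topologicalClosure_pairRange_mul hef hg]
  have hgraph : (opMul (ofBounded C) B).graph.topologicalClosure = A.graph := by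
    rw [← hcore, hcl]
    refine (topologicalClosure_pairRange_eq_of_le hR hm hnA hd hef ?_).symm
    rw [← hcl]
    exact hmCB.trans (Submodule.le_topologicalClosure _)
  refine LinearPMap.eq_of_eq_graph ?_
  rw [← hgraph]
  exact LinearPMap.IsClosable.graph_closure_eq_closure_graph ⟨A, hgraph⟩

theorem affLE_of_eq_strongMul (hR : IsFinite R) {A B : H →ₗ.[ℂ] H}
    (hA : IsAffiliated R A) (hB : IsAffiliated R B) {C : H →L[ℂ] H} (hC : ‖C‖ ≤ 1)
    (hACB : A = strongMul (ofBounded C) B) :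
    AffLE R (strongMul A† A) (strongMul B† B) := by
  obtain ⟨m, nA, nB, rA, rB, hm, -, -, hrAR, hrBR, hd, -, -, hrA, hrB⟩ :=
    exists_common_domain hR hA hB
  rw [hA.strongMul_adjoint_self, hB.strongMul_adjoint_self]
  refine ⟨hA.adjoint_opMul, hA.isSelfAdjoint_adjoint_opMul, hB.adjoint_opMul,
    hB.isSelfAdjoint_adjoint_opMul, ?_⟩
  obtain ⟨hcl, hsa⟩ := isSelfAdjoint_closure_of_symmetric hR
    (S := opMul B† B - opMul A† A) hm (sub_mem hrBR hrAR) hd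
    (fun x => mem_graph_sub.2 ⟨_, _, hrB x, hrA x, rfl⟩) (by
      intro x y x' y' h h'
      obtain ⟨b, a, hb, ha, rfl⟩ := mem_graph_sub.1 h
      obtain ⟨b', a', hb', ha', rfl⟩ := mem_graph_sub.1 h'
      rw [inner_sub_left, inner_sub_right, adjoint_opMul_symmetric hB.dense_domain hb hb',
        adjoint_opMul_symmetric hA.dense_domain ha ha'])
  refine ⟨hsa, fun w => ?_⟩
  have hw := (opMul B† B - opMul A† A).closure.mem_graph w
  rw [← hcl.graph_closure_eq_closure_graph] at hw
  -- Nonnegativity of the form is a closed condition on graph points, so it passes from `B† B - A†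
  -- A` to its closure.
  have hc : IsClosed {z : H × H | 0 ≤ (inner ℂ z.2 z.1).re} :=
    isClosed_le continuous_const (Complex.continuous_re.comp (by fun_prop))
  refine closure_minimal ?_ hc hw
  rintro ⟨x, y⟩ hxy
  obtain ⟨z, y, hz, hy, rfl⟩ := mem_graph_sub.1 hxy
  obtain ⟨b, hb, -⟩ := mem_graph_opMul.1 hz
  have ha : (x, C b) ∈ A.graph := by
    rw [hACB]
    exact LinearPMap.le_graph_of_le (LinearPMap.le_closure _)
      (mem_graph_opMul.2 ⟨b, hb, mem_graph_ofBounded.2 rfl⟩)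
  change 0 ≤ (inner ℂ (z - y) x).re
  rw [re_inner_adjoint_opMul_sub hA.dense_domain hB.dense_domain ha hb hy hz, sub_nonneg]
  exact pow_le_pow_left₀ (norm_nonneg _) (C.le_of_opNorm_le hC b |>.trans_eq (one_mul _)) 2

end MurrayVonNeumann

theorem proposition2p8 {H : Type*} [NormedAddCommGroup H] [InnerProductSpace ℂ H] [CompleteSpace H]
    (R : VonNeumannAlgebra H) (hR : MurrayVonNeumann.IsFinite R)
    (A B : H →ₗ.[ℂ] H)
    (hA : MurrayVonNeumann.IsAffiliated R A) (hB : MurrayVonNeumann.IsAffiliated R B) :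
    MurrayVonNeumann.AffLE R
        (MurrayVonNeumann.strongMul A† A) (MurrayVonNeumann.strongMul B† B) ↔
      ∃ C ∈ R, ‖C‖ ≤ 1 ∧
        A = MurrayVonNeumann.strongMul (MurrayVonNeumann.ofBounded C) B := by
  constructor
  · exact MurrayVonNeumann.exists_eq_strongMul_of_affLE hR hA hB
  · rintro ⟨C, -, hC, h⟩
    exact MurrayVonNeumann.affLE_of_eq_strongMul hR hA hB hC h
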